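/- Let $X$ be a locally compact second countable Hausdorff space, let $U,V\subseteq X$ be open and let $\theta:U\to V$ be a homeomorphism. Let $\mathcal V$ be a locally trivial complex vector bundle over $U$ whose fibres have finite dimension at least one (the rank is locally constant, but need not be constant), and let $\beta$ be a Hermitian metric on $\mathcal V$, linear in the second variable. Let $\mathcal E=\Gamma_0(\mathcal V,\theta)$ be the space of continuous sections $\xi$ of $\mathcal V$ such that $x\mapsto\beta(\xi(x),\xi(x))$ vanishes at infinity on $U$, with right multiplication $(\xi f)(x)=\xi(x)f(x)$ for $f\in C_0(X)$, with the $C_0(X)$-valued inner product $\langle\xi,\eta\rangle_{\mathcal E}(x)=\beta(\xi(x),\eta(x))$ for $x\in U$ and $\langle\xi,\eta\rangle_{\mathcal E}(x)=0$ for $x\notin U$, and with left action $(\varphi_{\mathcal E}(f)\xi)(x)=\xi(x)f(\theta(x))$ for $f\in C_0(X)$. Let $\mathcal K(\mathcal E)$ denote the compact operators on $\mathcal E$, that is, the closure in operator norm, inside the adjointable operators, of the linear span of the operators $\zeta\mapsto\xi\langle\eta,\zeta\rangle_{\mathcal E}$ with $\xi,\eta\in\mathcal E$, and regard $C_0(V)$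 as the ideal of functions in $C_0(X)$ vanishing outside $V$. A Hilbert $C_0(X)$-bimodule is a space that is both a right and a left Hilbert $C_0(X)$-module (in particular complete for both norms) such that $a(\xi b)=(a\xi)b$ and ${}_{\mathcal E}\langle\xi,\eta\rangle\zeta=\xi\langle\eta,\zeta\rangle_{\mathcal E}$ for all $\xi,\eta,\zeta$ in the space and all $a,b\in C_0(X)$. Then: 1. $\varphi_{\mathcal E}(C_0(V))=\mathcal K(\mathcal E)$ if and only if $\mathcal V$ is a line bundle, that is, all its fibres have dimension one. 2. With left multiplication $f\xi=\varphi_{\mathcal E}(f)\xi$ and left inner product ${}_{\mathcal E}\langle\xi,\eta\rangle=\langle\eta,\xi\rangle_{\mathcal E}\circ\theta^{-1}$ (extended by zero outside $V$), $\mathcal E$ is a Hilbert $C_0(X)$-bimodule if and only if $\mathcal V$ is a line bundle. 3. There is some left inner product which, together with the left multiplication $f\xi=\varphi_{\mathcal E}(f)\xi$, makes $\mathcal E$ a Hilbert $C_0(X)$-bimodule if and only if $\mathcal V$ is a line bundle. -/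

import Mathlib

open Filter Topology TopologicalSpace Bundle
open scoped ZeroAtInfty

noncomputable section

/-! ### Hilbert modules over a C⋆-algebra -/

section HilbertModules

variable {A E : Type*} [NonUnitalCStarAlgebra A] [AddCommGroup E] [Module ℂ E]

/-- The norm `‖x‖ = ‖⟨x, x⟩‖^(1/2)` defined by an `A`-valued inner product. -/
def moduleNorm (ip : E → E → A) (x : E) : ℝ := √‖ip x x‖

/-- Every Cauchy sequence for `moduleNorm ip` converges. -/
def IsModuleComplete (ip : E → E → A) : Prop :=
  ∀ u : ℕ → E,
    (∀ ε > 0, ∃ N, ∀ m ≥ N, ∀ n ≥ N, moduleNorm ip (u m - u n) < ε) →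
    ∃ x, ∀ ε > 0, ∃ N, ∀ n ≥ N, moduleNorm ip (u n - x) < ε

/-- `E` is a right Hilbert `A`-module with right multiplication `ract x a = x a` and
inner product `ip`, which is linear in the second variable. -/
structure IsRightHilbertModule (ract : E → A → E) (ip : E → E → A) : Prop where
  ract_add : ∀ x a b, ract x (a + b) = ract x a + ract x b
  add_ract : ∀ x y a, ract (x + y) a = ract x a + ract y a
  ract_mul : ∀ x a b, ract x (a * b) = ract (ract x a) b
  ract_smul : ∀ (c : ℂ) x a, ract x (c • a) = c • ract x a
  smul_ract : ∀ (c : ℂ) x a, ract (c • x) a = c • ract x a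
  ip_add : ∀ x y z, ip x (y + z) = ip x y + ip x z
  ip_smul : ∀ (c : ℂ) x y, ip x (c • y) = c • ip x y
  ip_ract : ∀ x y a, ip x (ract y a) = ip x y * a
  star_ip : ∀ x y, star (ip x y) = ip y x
  ip_self_nonneg : ∀ x, ∃ a, ip x x = star a * a
  ip_definite : ∀ x, ip x x = 0 → x = 0
  complete : IsModuleComplete ip

/-- `E` is a left Hilbert `A`-module with left multiplication `lact a x = a x` and
inner product `ip`, which is linear in the first variable. -/
structure IsLeftHilbertModule (lact : A → E → E) (ip : E → E → A) : Prop where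
  add_lact : ∀ a b x, lact (a + b) x = lact a x + lact b x
  lact_add : ∀ a x y, lact a (x + y) = lact a x + lact a y
  mul_lact : ∀ a b x, lact (a * b) x = lact a (lact b x)
  smul_lact : ∀ (c : ℂ) a x, lact (c • a) x = c • lact a x
  lact_smul : ∀ (c : ℂ) a x, lact a (c • x) = c • lact a x
  add_ip : ∀ x y z, ip (x + y) z = ip x z + ip y z
  smul_ip : ∀ (c : ℂ) x y, ip (c • x) y = c • ip x y
  lact_ip : ∀ a x y, ip (lact a x) y = a * ip x y
  star_ip : ∀ x y, star (ip x y) = ip y x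
  ip_self_nonneg : ∀ x, ∃ a, ip x x = star a * a
  ip_definite : ∀ x, ip x x = 0 → x = 0
  complete : IsModuleComplete ip

/-- `E` is a Hilbert `A`-bimodule: a right and a left Hilbert `A`-module such that
`a (x b) = (a x) b` and `lip x y · z = x · rip y z`. -/
structure IsHilbertBimodule (lact : A → E → E) (lip : E → E → A)
    (ract : E → A → E) (rip : E → E → A) : Prop where
  right : IsRightHilbertModule ract rip
  left : IsLeftHilbertModule lact lip
  assoc : ∀ a x b, lact a (ract x b) = ract (lact a x) b
  compat : ∀ x y z, lact (lip x y) z = ract x (rip y z)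

/-- The operator `T` has an adjoint with respect to the inner product `ip`. -/
def IsAdjointable (ip : E → E → A) (T : E →ₗ[ℂ] E) : Prop :=
  ∃ S : E →ₗ[ℂ] E, ∀ x y, ip (T x) y = ip x (S y)

/-- The compact operators on the right Hilbert module `E`: the adjointable operators that are
limits in operator norm of linear combinations of the rank-one operators `z ↦ x ⟨y, z⟩`. -/
def compactOperators (ract : E → A → E) (ip : E → E → A) : Set (E →ₗ[ℂ] E) :=
  {T | IsAdjointable ip T ∧ ∀ ε > 0,
    ∃ F ∈ Submodule.span ℂ {R : E →ₗ[ℂ] E | ∃ x y, ∀ z, R z = ract x (ip y z)},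
      ∀ z, moduleNorm ip (T z - F z) ≤ ε * moduleNorm ip z}

end HilbertModules

/-! ### Complex vector bundles and Hermitian metrics -/

/-- A complex vector bundle over `B`. The rank is finite, at least one, and locally constant,
but it may differ between components of `B`. -/
structure ComplexVectorBundle.{u, v} (B : Type u) [TopologicalSpace B] where
  /-- The fibres. -/
  Fiber : B → Type v
  [addCommGroup : ∀ b, AddCommGroup (Fiber b)]
  [module : ∀ b, Module ℂ (Fiber b)]
  /-- The topology of the total space; the first argument of `TotalSpace` is a dummy. -/
  [topology : TopologicalSpace (TotalSpace Unit Fiber)]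
  locally_trivial : ∀ b, ∃ (n : ℕ)
    (e : Trivialization (EuclideanSpace ℂ (Fin n)) (TotalSpace.proj : TotalSpace Unit Fiber → B)),
      0 < n ∧ b ∈ e.baseSet ∧
        ∀ x ∈ e.baseSet, IsLinearMap ℂ (fun v : Fiber x ↦ (e ⟨x, v⟩).2)

attribute [instance] ComplexVectorBundle.addCommGroup ComplexVectorBundle.module
  ComplexVectorBundle.topology

namespace ComplexVectorBundle

variable {B : Type*} [TopologicalSpace B]

/-- The total space. -/
abbrev Total (𝒱 : ComplexVectorBundle B) : Type _ := TotalSpace Unit 𝒱.Fiber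

/-- All fibres are one-dimensional. -/
def IsLineBundle (𝒱 : ComplexVectorBundle B) : Prop :=
  ∀ b, Module.finrank ℂ (𝒱.Fiber b) = 1

/-- A Hermitian metric: an inner product on each fibre (linear in the second variable) that is
continuous on the total space of the Whitney sum `𝒱 ⊕ 𝒱`. -/
structure HermitianMetric (𝒱 : ComplexVectorBundle B) where
  /-- The inner product on each fibre. -/
  core : ∀ b, InnerProductSpace.Core ℂ (𝒱.Fiber b)
  continuous_inner : Continuous
    (fun q : TotalSpace (Unit × Unit) (𝒱.Fiber ×ᵇ 𝒱.Fiber) ↦ (core q.1).inner q.2.1 q.2.2)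

/-- The value `β(v, w)`. -/
def HermitianMetric.ip {𝒱 : ComplexVectorBundle B} (β : 𝒱.HermitianMetric) {b : B}
    (v w : 𝒱.Fiber b) : ℂ := (β.core b).inner v w

variable {𝒱 : ComplexVectorBundle B}

/-- A section, seen as a map into the total space. -/
def sec (ξ : ∀ b, 𝒱.Fiber b) (b : B) : 𝒱.Total := ⟨b, ξ b⟩

theorem continuousAt_sec_iff {n : ℕ}
    (e : Trivialization (EuclideanSpace ℂ (Fin n)) (TotalSpace.proj : 𝒱.Total → B))
    {b : B} (hb : b ∈ e.baseSet) (ξ : ∀ b, 𝒱.Fiber b) :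
    ContinuousAt (sec ξ) b ↔ ContinuousAt (fun x ↦ (e (sec ξ x)).2) b := by
  have hsrc : sec ξ b ∈ e.source := e.mem_source.2 hb
  constructor
  · intro h
    exact continuousAt_snd.comp (ContinuousAt.comp (e.continuousAt hsrc) h)
  · intro h
    refine e.continuousAt_of_comp_left (f := sec ξ) continuousAt_id hb ?_
    have h2 : ContinuousAt (fun x ↦ (x, (e (sec ξ x)).2)) b := continuousAt_id.prodMk h
    refine h2.congr ?_
    filter_upwards [e.open_baseSet.mem_nhds hb] with x hx
    exact Prod.ext (e.coe_fst (e.mem_source.2 (show (sec ξ x).proj ∈ e.baseSet from hx))).symm rfl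

theorem continuous_sec_add {ξ η : ∀ b, 𝒱.Fiber b} (hξ : Continuous (sec ξ))
    (hη : Continuous (sec η)) : Continuous (sec (ξ + η)) := by
  refine continuous_iff_continuousAt.2 fun b ↦ ?_
  obtain ⟨n, e, -, hb, hlin⟩ := 𝒱.locally_trivial b
  have h1 := (continuousAt_sec_iff e hb ξ).1 hξ.continuousAt
  have h2 := (continuousAt_sec_iff e hb η).1 hη.continuousAt
  refine (continuousAt_sec_iff e hb _).2 ((h1.add h2).congr ?_)
  filter_upwards [e.open_baseSet.mem_nhds hb] with x hx
  exact ((hlin x hx).map_add (ξ x) (η x)).symm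

theorem continuous_sec_smul {f : B → ℂ} {ξ : ∀ b, 𝒱.Fiber b} (hf : Continuous f)
    (hξ : Continuous (sec ξ)) : Continuous (sec (fun b ↦ f b • ξ b)) := by
  refine continuous_iff_continuousAt.2 fun b ↦ ?_
  obtain ⟨n, e, -, hb, hlin⟩ := 𝒱.locally_trivial b
  have h1 := (continuousAt_sec_iff e hb ξ).1 hξ.continuousAt
  refine (continuousAt_sec_iff e hb _).2 ((hf.continuousAt.smul h1).congr ?_)
  filter_upwards [e.open_baseSet.mem_nhds hb] with x hx
  exact ((hlin x hx).map_smul (f x) (ξ x)).symm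

theorem continuous_sec_zero : Continuous (sec (0 : ∀ b, 𝒱.Fiber b)) := by
  refine continuous_iff_continuousAt.2 fun b ↦ ?_
  obtain ⟨n, e, -, hb, hlin⟩ := 𝒱.locally_trivial b
  refine (continuousAt_sec_iff e hb _).2
    ((continuousAt_const (y := (0 : EuclideanSpace ℂ (Fin n)))).congr ?_)
  filter_upwards [e.open_baseSet.mem_nhds hb] with x hx
  exact ((hlin x hx).map_zero).symm

namespace HermitianMetric

variable (β : 𝒱.HermitianMetric)

theorem continuous_ip {ξ η : ∀ b, 𝒱.Fiber b} (hξ : Continuous (sec ξ))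
    (hη : Continuous (sec η)) : Continuous (fun b ↦ β.ip (ξ b) (η b)) := by
  have h : Continuous (fun b ↦
      (⟨b, (ξ b, η b)⟩ : TotalSpace (Unit × Unit) (𝒱.Fiber ×ᵇ 𝒱.Fiber))) :=
    (FiberBundle.Prod.isInducing_diag Unit 𝒱.Fiber Unit 𝒱.Fiber).continuous_iff.2
      (hξ.prodMk hη)
  exact β.continuous_inner.comp h

theorem norm_ip_le {b : B} (v w : 𝒱.Fiber b) :
    ‖β.ip v w‖ ≤ ‖β.ip v v‖ + ‖β.ip w w‖ := by
  let := β.core b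
  let : NormedAddCommGroup (𝒱.Fiber b) := (β.core b).toNormedAddCommGroup
  let : InnerProductSpace ℂ (𝒱.Fiber b) := InnerProductSpace.ofCore (β.core b).toCore
  change ‖inner ℂ v w‖ ≤ ‖inner ℂ v v‖ + ‖inner ℂ w w‖
  have h := norm_inner_le_norm (𝕜 := ℂ) v w
  rw [inner_self_eq_norm_sq_to_K, inner_self_eq_norm_sq_to_K]
  simp only [norm_pow, Complex.coe_algebraMap, Complex.norm_real, norm_norm]
  nlinarith [sq_nonneg (‖v‖ - ‖w‖), sq_nonneg ‖v‖, sq_nonneg ‖w‖]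

theorem norm_ip_add_le {b : B} (v w : 𝒱.Fiber b) :
    ‖β.ip (v + w) (v + w)‖ ≤ 3 * (‖β.ip v v‖ + ‖β.ip w w‖) := by
  have h : β.ip (v + w) (v + w) = β.ip v v + β.ip v w + (β.ip w v + β.ip w w) := by
    let := β.core b
    let : NormedAddCommGroup (𝒱.Fiber b) := (β.core b).toNormedAddCommGroup
    let : InnerProductSpace ℂ (𝒱.Fiber b) := InnerProductSpace.ofCore (β.core b).toCore
    change inner ℂ (v + w) (v + w) = inner ℂ v v + inner ℂ v w + (inner ℂ w v + inner ℂ w w)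
    rw [inner_add_left, inner_add_right, inner_add_right]
  rw [h]
  have h1 := β.norm_ip_le v w
  have h2 := β.norm_ip_le w v
  calc _ ≤ ‖β.ip v v + β.ip v w‖ + ‖β.ip w v + β.ip w w‖ := norm_add_le _ _
    _ ≤ (‖β.ip v v‖ + ‖β.ip v w‖) + (‖β.ip w v‖ + ‖β.ip w w‖) :=
      add_le_add (norm_add_le _ _) (norm_add_le _ _)
    _ ≤ _ := by linarith

theorem ip_smul_smul {b : B} (c : ℂ) (v : 𝒱.Fiber b) :
    β.ip (c • v) (c • v) = (‖c‖ ^ 2 : ℝ) * β.ip v v := by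
  let := β.core b
  let : NormedAddCommGroup (𝒱.Fiber b) := (β.core b).toNormedAddCommGroup
  let : InnerProductSpace ℂ (𝒱.Fiber b) := InnerProductSpace.ofCore (β.core b).toCore
  change inner ℂ (c • v) (c • v) = (‖c‖ ^ 2 : ℝ) * inner ℂ v v
  rw [inner_smul_left, inner_smul_right, ← mul_assoc, Complex.conj_mul']
  push_cast
  rfl

theorem tendsto_ip_smul {f : B → ℂ} {C : ℝ} (hf : ∀ b, ‖f b‖ ≤ C) {ξ : ∀ b, 𝒱.Fiber b}
    (hξ : Tendsto (fun b ↦ β.ip (ξ b) (ξ b)) (cocompact B) (𝓝 0)) :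
    Tendsto (fun b ↦ β.ip (f b • ξ b) (f b • ξ b)) (cocompact B) (𝓝 0) := by
  have h := (tendsto_zero_iff_norm_tendsto_zero.1 hξ).const_mul (C ^ 2)
  rw [mul_zero] at h
  refine squeeze_zero_norm (fun b ↦ ?_) h
  rw [ip_smul_smul, norm_mul, Complex.norm_real, Real.norm_of_nonneg (by positivity)]
  gcongr
  exact hf b

/-- The space `Γ₀(𝒱)` of continuous sections of `𝒱` vanishing at infinity with respect to `β`. -/
def sections : Submodule ℂ (∀ b, 𝒱.Fiber b) where
  carrier := {ξ | Continuous (sec ξ) ∧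
    Tendsto (fun b ↦ β.ip (ξ b) (ξ b)) (cocompact B) (𝓝 0)}
  add_mem' := by
    rintro ξ η ⟨hξ, hξ'⟩ ⟨hη, hη'⟩
    refine ⟨continuous_sec_add hξ hη, ?_⟩
    have h := ((tendsto_zero_iff_norm_tendsto_zero.1 hξ').add
      (tendsto_zero_iff_norm_tendsto_zero.1 hη')).const_mul 3
    rw [add_zero, mul_zero] at h
    exact squeeze_zero_norm (fun b ↦ β.norm_ip_add_le (ξ b) (η b)) h
  zero_mem' := by
    refine ⟨continuous_sec_zero, ?_⟩
    have h : ∀ b, β.ip ((0 : ∀ b, 𝒱.Fiber b) b) ((0 : ∀ b, 𝒱.Fiber b) b) = 0 := fun b ↦ by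
      simpa using β.ip_smul_smul (b := b) 0 0
    simp only [h]
    exact tendsto_const_nhds
  smul_mem' := by
    rintro c ξ ⟨hξ, hξ'⟩
    exact ⟨continuous_sec_smul continuous_const hξ, β.tendsto_ip_smul (fun _ ↦ le_rfl) hξ'⟩

/-- The product of a section in `Γ₀(𝒱)` with a bounded continuous function. -/
def mulSection (f : BoundedContinuousFunction B ℂ) : β.sections →ₗ[ℂ] β.sections where
  toFun ξ := ⟨fun b ↦ f b • ξ.1 b, continuous_sec_smul f.continuous ξ.2.1,
    β.tendsto_ip_smul f.norm_coe_le_norm ξ.2.2⟩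
  map_add' ξ η := Subtype.ext <| funext fun b ↦ smul_add (f b) (ξ.1 b) (η.1 b)
  map_smul' c ξ := Subtype.ext <| funext fun b ↦ smul_comm (f b) c (ξ.1 b)

/-- The function `b ↦ β(ξ(b), η(b))`, which vanishes at infinity on `B`. -/
def baseInner (ξ η : β.sections) : C₀(B, ℂ) where
  toFun b := β.ip (ξ.1 b) (η.1 b)
  continuous_toFun := β.continuous_ip ξ.2.1 η.2.1
  zero_at_infty' := by
    have h := (tendsto_zero_iff_norm_tendsto_zero.1 ξ.2.2).add
      (tendsto_zero_iff_norm_tendsto_zero.1 η.2.2)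
    rw [add_zero] at h
    exact squeeze_zero_norm (fun b ↦ β.norm_ip_le (ξ.1 b) (η.1 b)) h

end HermitianMetric

end ComplexVectorBundle

/-! ### Functions vanishing at infinity on open subsets -/

section ExtendZero

variable {X : Type*} [TopologicalSpace X]

open Classical in
/-- The extension by zero of a function on an open subset. -/
def zeroExtension (U : Opens X) (g : U → ℂ) (x : X) : ℂ :=
  if h : x ∈ U then g ⟨x, h⟩ else 0

theorem exists_compact_zeroExtension (U : Opens X) (g : C₀(U, ℂ)) {ε : ℝ} (hε : 0 < ε) :
    ∃ K : Set X, IsCompact K ∧ K ⊆ U ∧ ∀ x ∉ K, ‖zeroExtension U g x‖ < ε := by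
  have h := (tendsto_zero_iff_norm_tendsto_zero.1 g.zero_at_infty').eventually (gt_mem_nhds hε)
  obtain ⟨K, hK, hsub⟩ := mem_cocompact.1 h
  refine ⟨Subtype.val '' K, hK.image continuous_subtype_val, ?_, fun x hx ↦ ?_⟩
  · rintro _ ⟨y, -, rfl⟩
    exact y.2
  · unfold zeroExtension
    split_ifs with hU
    · exact hsub fun hmem ↦ hx ⟨⟨x, hU⟩, hmem, rfl⟩
    · simpa using hε

variable [T2Space X]

/-- The inclusion `C₀(U) → C₀(X)` given by extension by zero, for `U` open in `X`. -/
def extendZero (U : Opens X) (g : C₀(U, ℂ)) : C₀(X, ℂ) where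
  toFun := zeroExtension U g
  continuous_toFun := by
    refine continuous_iff_continuousAt.2 fun x ↦ ?_
    by_cases hx : x ∈ U
    · refine (U.isOpen.isOpenEmbedding_subtypeVal.continuousAt_iff (x := ⟨x, hx⟩)).1 ?_
      refine g.continuous.continuousAt.congr (Eventually.of_forall fun y ↦ ?_)
      simp [zeroExtension]
    · have h0 : zeroExtension U g x = 0 := by simp [zeroExtension, hx]
      rw [ContinuousAt, h0, Metric.tendsto_nhds]
      intro ε hε
      obtain ⟨K, hK, hKU, hlt⟩ := exists_compact_zeroExtension U g hε
      filter_upwards [hK.isClosed.isOpen_compl.mem_nhds fun h ↦ hx (hKU h)] with y hy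
      simpa using hlt y hy
  zero_at_infty' := by
    rw [Metric.tendsto_nhds]
    intro ε hε
    obtain ⟨K, hK, -, hlt⟩ := exists_compact_zeroExtension U g hε
    filter_upwards [hK.compl_mem_cocompact] with y hy
    simpa using hlt y hy

/-- The ideal `C₀(V)` of `C₀(X)`, for `V` open in `X`: the functions vanishing outside `V`. -/
def idealOfOpen (V : Opens X) : Set C₀(X, ℂ) := {f | ∀ x ∉ V, f x = 0}

end ExtendZero

/-! ### The correspondence of a partial automorphism and a vector bundle -/

namespace Correspondence

variable {X : Type*} [TopologicalSpace X] {U V : Opens X} {𝒱 : ComplexVectorBundle U}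

/-- The right multiplication `(ξ f)(x) = ξ(x) f(x)` of `C₀(X)` on `Γ₀(𝒱)`. -/
def rightMul (β : 𝒱.HermitianMetric) (ξ : β.sections) (f : C₀(X, ℂ)) : β.sections :=
  β.mulSection (f.toBCF.compContinuous ⟨Subtype.val, continuous_subtype_val⟩) ξ

/-- The structure map `(φ(f) ξ)(x) = ξ(x) f(θ(x))`. -/
def structureMap (θ : U ≃ₜ V) (β : 𝒱.HermitianMetric) (f : C₀(X, ℂ)) :
    β.sections →ₗ[ℂ] β.sections :=
  β.mulSection
    (f.toBCF.compContinuous ⟨fun x ↦ (θ x : X), continuous_subtype_val.comp θ.continuous⟩)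

/-- The left multiplication `f ξ = φ(f) ξ`. -/
def leftMul (θ : U ≃ₜ V) (β : 𝒱.HermitianMetric) (f : C₀(X, ℂ)) (ξ : β.sections) : β.sections :=
  structureMap θ β f ξ

variable [T2Space X]

/-- The `C₀(X)`-valued inner product `⟨ξ, η⟩(x) = β(ξ(x), η(x))`, zero outside `U`. -/
def rightInner (β : 𝒱.HermitianMetric) (ξ η : β.sections) : C₀(X, ℂ) :=
  extendZero U (β.baseInner ξ η)

/-- The function `⟨η, ξ⟩ ∘ θ⁻¹` on `V`, zero outside `V`. -/
def leftInner (θ : U ≃ₜ V) (β : 𝒱.HermitianMetric) (ξ η : β.sections) : C₀(X, ℂ) :=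
  extendZero V ((β.baseInner η ξ).comp θ.symm.toCocompactMap)

end Correspondence

end

/-!
Multiplication operators represent `C₀(U)` isometrically on `Γ₀(𝒱)`, because every vector extends
to a section whose norm is attained at its base point. Composition with `θ` identifies
`C₀(V)` with `C₀(U)`, so `φ(C₀(V))` is exactly the norm-closed set of multiplication operators.

If the fibres are one-dimensional, then `β(v, w) u = β(v, u) w`, i.e. the rank-one operator
`ξ⟨η, ·⟩` is multiplication by `⟨η, ξ⟩`. Such inner products span a dense subspace of `C₀(U)`:
finitely many sections have no common zero on a given compact set, and dividing by the sum of their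
squared norms (bounded below by a positive constant) approximates any function concentrated there.
Hence the compact operators are precisely the multiplication operators.

Conversely, `φ(C₀(V)) = 𝒦(ℰ)` and the compatibility of the two inner products of a bimodule both
force every rank-one operator to act by a scalar on each fibre; as sections attain all values, this
is possible only on a one-dimensional fibre.
-/

noncomputable section

/-! ### Hilbert modules -/

section HilbertModules

variable {A E : Type*} [AddCommGroup E]

theorem IsModuleComplete.of_moduleNorm_eq {A' : Type*} [NonUnitalCStarAlgebra A]
    [NonUnitalCStarAlgebra A'] {ip : E → E → A} {ip' : E → E → A'} (h : IsModuleComplete ip)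
    (heq : moduleNorm ip' = moduleNorm ip) : IsModuleComplete ip' := by
  unfold IsModuleComplete
  rwa [heq]

variable [Module ℂ E]

theorem IsLeftHilbertModule.flip [NonUnitalCommCStarAlgebra A] {lact : A → E → E}
    {ip : E → E → A} (h : IsLeftHilbertModule lact ip) :
    IsRightHilbertModule (fun x a ↦ lact a x) (fun x y ↦ ip y x) where
  ract_add x a b := h.add_lact a b x
  add_ract x y a := h.lact_add a x y
  ract_mul x a b := by rw [mul_comm, h.mul_lact]
  ract_smul c x a := h.smul_lact c a x
  smul_ract c x a := h.lact_smul c a x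
  ip_add x y z := h.add_ip y z x
  ip_smul c x y := h.smul_ip c y x
  ip_ract x y a := by rw [h.lact_ip, mul_comm]
  star_ip x y := h.star_ip y x
  ip_self_nonneg := h.ip_self_nonneg
  ip_definite := h.ip_definite
  complete := h.complete

variable [NonUnitalCStarAlgebra A] {ract : E → A → E} {ip : E → E → A}

namespace IsRightHilbertModule

theorem ip_ract_left (h : IsRightHilbertModule ract ip) (x y : E) (a : A) :
    ip (ract x a) y = star a * ip x y := by
  rw [← h.star_ip, h.ip_ract, star_mul, h.star_ip]

theorem moduleNorm_zero (h : IsRightHilbertModule ract ip) : moduleNorm ip 0 = 0 := by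
  have hzero : ip 0 0 = 0 := by simpa using h.ip_smul 0 0 0
  simp [moduleNorm, hzero]

/-- The rank-one operator `z ↦ x ⟨y, z⟩`, the building block of the compact operators. -/
def rankOne (h : IsRightHilbertModule ract ip) (x y : E) : E →ₗ[ℂ] E where
  toFun z := ract x (ip y z)
  map_add' z w := by rw [h.ip_add, h.ract_add]
  map_smul' c z := by rw [h.ip_smul, h.ract_smul, RingHom.id_apply]

theorem isAdjointable_rankOne (h : IsRightHilbertModule ract ip) (x y : E) :
    IsAdjointable ip (h.rankOne x y) :=
  ⟨h.rankOne y x, fun z w ↦ by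
    change ip (ract x (ip y z)) w = ip z (ract y (ip x w))
    rw [h.ip_ract_left, h.star_ip, h.ip_ract]⟩

theorem rankOne_mem_compactOperators (h : IsRightHilbertModule ract ip) (x y : E) :
    h.rankOne x y ∈ compactOperators ract ip :=
  ⟨h.isAdjointable_rankOne x y, fun ε hε ↦
    ⟨h.rankOne x y, Submodule.subset_span ⟨x, y, fun _ ↦ rfl⟩, fun z ↦ by
      rw [sub_self, h.moduleNorm_zero]
      exact mul_nonneg hε.le (Real.sqrt_nonneg _)⟩⟩

end IsRightHilbertModule

end HilbertModules

/-! ### Metric and topological preliminaries -/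

theorem exists_forall_dist_le_of_dist_le_add {α : Type*} [PseudoMetricSpace α] [CompleteSpace α]
    {g : ℝ → α} (hg : ∀ ε > 0, ∀ δ > 0, dist (g ε) (g δ) ≤ ε + δ) :
    ∃ x, ∀ ε > 0, dist (g ε) x ≤ ε := by
  let r : ℕ → ℝ := fun n ↦ 1 / ((n : ℝ) + 1)
  have hr_pos : ∀ n, 0 < r n := fun n ↦ Nat.one_div_pos_of_nat
  have hr : Tendsto r atTop (𝓝 0) := tendsto_one_div_add_atTop_nhds_zero_nat
  have hcauchy : CauchySeq fun n ↦ g (r n) := by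
    refine cauchySeq_of_le_tendsto_0 (fun n ↦ r n + r n) (fun n m N hn hm ↦ ?_)
      (by simpa using hr.add hr)
    exact (hg _ (hr_pos n) _ (hr_pos m)).trans
      (add_le_add (Nat.one_div_le_one_div hn) (Nat.one_div_le_one_div hm))
  obtain ⟨x, hx⟩ := cauchySeq_tendsto_of_complete hcauchy
  refine ⟨x, fun ε hε ↦ le_of_tendsto_of_tendsto' (tendsto_const_nhds.dist hx) ?_
    fun n ↦ hg ε hε (r n) (hr_pos n)⟩
  simpa using hr.const_add ε

theorem exists_eventually_norm_le_mul_of_homogeneous {𝕜 B F : Type*} [RCLike 𝕜]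
    [TopologicalSpace B] [NormedAddCommGroup F] [NormedSpace 𝕜 F] [ProperSpace F]
    {N : B → F → ℝ} {b : B} (hcont : ∀ y, ContinuousAt (Function.uncurry N) (b, y))
    (hsmul : ∀ᶠ x in 𝓝 b, ∀ (c : 𝕜) y, N x (c • y) = ‖c‖ * N x y)
    (hpos : ∀ y ≠ 0, 0 < N b y) :
    ∃ C > 0, ∀ᶠ x in 𝓝 b, ∀ y, ‖y‖ ≤ C * N x y := by
  have hsphere := isCompact_sphere (0 : F) 1
  obtain ⟨m, hm, hmN⟩ : ∃ m > 0, ∀ y ∈ Metric.sphere (0 : F) 1, m ≤ N b y :=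
    hsphere.exists_forall_le'
      (fun y _ ↦ ((hcont y).comp (f := fun y ↦ (b, y)) (by fun_prop)).continuousWithinAt)
      fun y hy ↦ hpos y (ne_zero_of_mem_unit_sphere ⟨y, hy⟩)
  have hlower : ∀ᶠ x in 𝓝 b, ∀ y ∈ Metric.sphere (0 : F) 1, m / 2 < N x y :=
    hsphere.eventually_forall_of_forall_eventually fun y hy ↦
      (hcont y).eventually (lt_mem_nhds ((half_lt_self hm).trans_le (hmN y hy)))
  refine ⟨(m / 2)⁻¹, by positivity, ?_⟩
  filter_upwards [hlower, hsmul] with x hx hsmulx y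
  rw [← div_eq_inv_mul, le_div_iff₀ (half_pos hm)]
  rcases eq_or_ne y 0 with rfl | hy
  · simpa using (hsmulx 0 0).ge
  have hunit : ((‖y‖⁻¹ : ℝ) : 𝕜) • y ∈ Metric.sphere (0 : F) 1 := by
    simp [norm_smul, hy]
  have hscaled := hx _ hunit
  rw [hsmulx, RCLike.norm_ofReal, abs_of_nonneg (by positivity), ← div_eq_inv_mul,
    lt_div_iff₀ (norm_pos_iff.2 hy)] at hscaled
  linarith

theorem exists_boundedContinuous_norm_sub_smul_le {B E : Type*} [TopologicalSpace B]
    [NormedAddCommGroup E] [NormedSpace ℝ E] (g : BoundedContinuousFunction B E) {H : B → ℝ}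
    (hH : Continuous H) (hH_nonneg : ∀ t, 0 ≤ H t) {δ ε : ℝ} (hδ : 0 < δ) (hε : 0 ≤ ε)
    (hgH : ∀ t, ε ≤ ‖g t‖ → δ ≤ H t) :
    ∃ k : BoundedContinuousFunction B E, ∀ t, ‖g t - H t • k t‖ ≤ ε := by
  have hmax : ∀ t, 0 < max (H t) δ := fun t ↦ lt_max_of_lt_right hδ
  let k : BoundedContinuousFunction B E := .ofNormedAddCommGroup
    (fun t ↦ (max (H t) δ)⁻¹ • g t)
    (((hH.max continuous_const).inv₀ fun t ↦ (hmax t).ne').smul g.continuous) (δ⁻¹ * ‖g‖)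
    fun t ↦ by
      rw [norm_smul, norm_inv, Real.norm_of_nonneg (hmax t).le]
      exact mul_le_mul (inv_anti₀ hδ (le_max_right _ _)) (g.norm_coe_le_norm t)
        (norm_nonneg _) (inv_pos.2 hδ).le
  have hk : ∀ t, g t - H t • k t = (1 - H t / max (H t) δ) • g t := fun t ↦ by
    rw [sub_smul, one_smul, div_eq_mul_inv, mul_smul]
    rfl
  refine ⟨k, fun t ↦ ?_⟩
  rw [hk, norm_smul]
  by_cases ht : δ ≤ H t
  · simpa [max_eq_left ht, (hδ.trans_le ht).ne'] using hε
  · have hgt : ‖g t‖ < ε := not_le.1 fun hle ↦ ht (hgH t hle)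
    have hfactor : ‖1 - H t / max (H t) δ‖ ≤ 1 := by
      have hquot : 0 ≤ H t / max (H t) δ := div_nonneg (hH_nonneg t) (hmax t).le
      have hquot_le : H t / max (H t) δ ≤ 1 := div_le_one_of_le₀ (le_max_left _ _) (hmax t).le
      rw [Real.norm_of_nonneg (by linarith)]
      linarith
    exact (mul_le_of_le_one_left (norm_nonneg _) hfactor).trans hgt.le

/-! ### Functions vanishing at infinity -/

section ZeroAtInfty

variable {X : Type*} [TopologicalSpace X]

theorem zeroAtInfty_sum_apply {ι : Type*} (s : Finset ι) (f : ι → C₀(X, ℂ)) (x : X) :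
    (∑ i ∈ s, f i) x = ∑ i ∈ s, f i x :=
  map_sum (⟨⟨fun g ↦ g x, rfl⟩, fun _ _ ↦ rfl⟩ : C₀(X, ℂ) →+ ℂ) f s

theorem norm_zeroAtInfty_le_iff (f : C₀(X, ℂ)) {C : ℝ} (hC : 0 ≤ C) :
    ‖f‖ ≤ C ↔ ∀ x, ‖f x‖ ≤ C := by
  rw [← ZeroAtInftyContinuousMap.norm_toBCF_eq_norm, BoundedContinuousFunction.norm_le hC]
  rfl

theorem norm_zeroAtInfty_apply_le (f : C₀(X, ℂ)) (x : X) : ‖f x‖ ≤ ‖f‖ :=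
  (norm_zeroAtInfty_le_iff f (norm_nonneg f)).1 le_rfl x

theorem norm_zeroAtInfty_comp_homeomorph {Y : Type*} [TopologicalSpace Y] (f : C₀(X, ℂ))
    (τ : Y ≃ₜ X) : ‖f.comp τ.toCocompactMap‖ = ‖f‖ := by
  refine le_antisymm ((norm_zeroAtInfty_le_iff _ (norm_nonneg f)).2 fun y ↦
    norm_zeroAtInfty_apply_le f (τ y)) ((norm_zeroAtInfty_le_iff _ (norm_nonneg _)).2 fun x ↦ ?_)
  obtain ⟨y, rfl⟩ := τ.surjective x
  exact norm_zeroAtInfty_apply_le (f.comp τ.toCocompactMap) y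

open scoped ComplexOrder in
theorem exists_eq_star_mul_self_of_nonneg {f : C₀(X, ℂ)} (hf : ∀ x, 0 ≤ f x) :
    ∃ a : C₀(X, ℂ), f = star a * a := by
  refine ⟨⟨⟨fun x ↦ ((√‖f x‖ : ℝ) : ℂ), by fun_prop⟩, ?_⟩, ?_⟩
  · have hsqrt := (tendsto_zero_iff_norm_tendsto_zero.1 f.zero_at_infty').sqrt
    rw [Real.sqrt_zero] at hsqrt
    simpa [Function.comp_def] using (Complex.continuous_ofReal.tendsto 0).comp hsqrt
  · ext x
    change f x = star ((√‖f x‖ : ℝ) : ℂ) * ((√‖f x‖ : ℝ) : ℂ)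
    rw [Complex.star_def, Complex.conj_ofReal, ← Complex.ofReal_mul,
      Real.mul_self_sqrt (norm_nonneg _)]
    exact Complex.eq_coe_norm_of_nonneg (hf x)

theorem isCompact_setOf_le_norm_zeroAtInfty (f : C₀(X, ℂ)) {ε : ℝ} (hε : 0 < ε) :
    IsCompact {x | ε ≤ ‖f x‖} := by
  have hsmall := (tendsto_zero_iff_norm_tendsto_zero.1 f.zero_at_infty').eventually
    (gt_mem_nhds hε)
  obtain ⟨K, hK, hsub⟩ := mem_cocompact.1 hsmall
  refine hK.of_isClosed_subset (isClosed_le continuous_const f.continuous.norm) fun x hx ↦ ?_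
  by_contra hxK
  have hlt : ‖f x‖ < ε := hsub hxK
  exact hlt.not_ge hx

theorem tendsto_cocompact_of_mem_idealOfOpen {W : Opens X} {f : C₀(X, ℂ)}
    (hf : f ∈ idealOfOpen W) : Tendsto (fun x : W ↦ f x) (cocompact W) (𝓝 0) := by
  refine Metric.tendsto_nhds.2 fun ε hε ↦ ?_
  have hcompact : IsCompact {x : W | ε ≤ ‖f x‖} := by
    refine Topology.IsInducing.subtypeVal.isCompact_iff.2 ?_
    convert isCompact_setOf_le_norm_zeroAtInfty f hε using 1
    refine Set.Subset.antisymm (Set.image_subset_iff.2 fun x hx ↦ hx) fun x hx ↦ ?_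
    have hxW : x ∈ W := by
      by_contra hxW
      simp [hf x hxW, hε.not_ge] at hx
    exact ⟨⟨x, hxW⟩, hx, rfl⟩
  filter_upwards [hcompact.compl_mem_cocompact] with x hx
  simpa using hx

variable [T2Space X] (W : Opens X)

theorem extendZero_apply_coe (g : C₀(W, ℂ)) (x : W) : extendZero W g x = g x := by
  change zeroExtension W g x = g x
  simp [zeroExtension]

theorem extendZero_apply_of_notMem (g : C₀(W, ℂ)) {x : X} (hx : x ∉ W) :
    extendZero W g x = 0 := by
  change zeroExtension W g x = 0
  simp [zeroExtension, hx]

theorem norm_extendZero (g : C₀(W, ℂ)) : ‖extendZero W g‖ = ‖g‖ := by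
  refine le_antisymm ((norm_zeroAtInfty_le_iff _ (norm_nonneg g)).2 fun x ↦ ?_)
    ((norm_zeroAtInfty_le_iff _ (norm_nonneg _)).2 fun x ↦ ?_)
  · by_cases hx : x ∈ W
    · rw [extendZero_apply_coe W g ⟨x, hx⟩]
      exact norm_zeroAtInfty_apply_le g _
    · simp [extendZero_apply_of_notMem W g hx]
  · rw [← extendZero_apply_coe]
    exact norm_zeroAtInfty_apply_le _ _

theorem range_extendZero : Set.range (extendZero W) = idealOfOpen W := by
  refine Set.Subset.antisymm ?_ fun f hf ↦ ?_
  · rintro _ ⟨g, rfl⟩ x hx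
    exact extendZero_apply_of_notMem W g hx
  · refine ⟨⟨⟨fun x ↦ f x, f.continuous.comp continuous_subtype_val⟩,
      tendsto_cocompact_of_mem_idealOfOpen hf⟩, ?_⟩
    ext x
    by_cases hx : x ∈ W
    · exact extendZero_apply_coe W _ ⟨x, hx⟩
    · rw [extendZero_apply_of_notMem W _ hx, hf x hx]

end ZeroAtInfty

namespace ComplexVectorBundle

variable {B : Type*} [TopologicalSpace B] {𝒱 : ComplexVectorBundle B}

/-! ### Local trivializations -/

section LocalTrivialization

variable {n : ℕ} {e : Trivialization (EuclideanSpace ℂ (Fin n)) (TotalSpace.proj : 𝒱.Total → B)}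
  (hlin : ∀ x ∈ e.baseSet, IsLinearMap ℂ (fun v : 𝒱.Fiber x ↦ (e ⟨x, v⟩).2))

/-- The linear isomorphism of a fibre with the model space given by a fibrewise linear
trivialization. -/
def fiberEquiv {b : B} (hb : b ∈ e.baseSet) : 𝒱.Fiber b ≃ₗ[ℂ] EuclideanSpace ℂ (Fin n) :=
  LinearEquiv.ofBijective (hlin b hb).mk' <| by
    have hsource : ∀ v : 𝒱.Fiber b, (⟨b, v⟩ : 𝒱.Total) ∈ e.source := fun v ↦ e.mem_source.2 hb
    refine ⟨fun v w hvw ↦ ?_, fun y ↦ ?_⟩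
    · have heq : e (⟨b, v⟩ : 𝒱.Total) = e ⟨b, w⟩ :=
        Prod.ext ((e.coe_fst (hsource v)).trans (e.coe_fst (hsource w)).symm) hvw
      simpa using e.injOn (hsource v) (hsource w) heq
    · have htarget : (b, y) ∈ e.target := e.mem_target.2 hb
      obtain ⟨⟨b', v⟩, hv, hey⟩ : ∃ z ∈ e.source, e z = (b, y) :=
        ⟨_, e.map_target htarget, e.apply_symm_apply htarget⟩
      obtain rfl : b' = b := (e.coe_fst hv).symm.trans (congrArg Prod.fst hey)
      exact ⟨v, congrArg Prod.snd hey⟩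

theorem fiberEquiv_apply {b : B} (hb : b ∈ e.baseSet) (v : 𝒱.Fiber b) :
    fiberEquiv hlin hb v = (e ⟨b, v⟩).2 := rfl

theorem toOpenPartialHomeomorph_symm_apply {b : B} (hb : b ∈ e.baseSet)
    (y : EuclideanSpace ℂ (Fin n)) :
    e.toOpenPartialHomeomorph.symm (b, y) = ⟨b, (fiberEquiv hlin hb).symm y⟩ := by
  have h := e.symm_apply_mk_proj (x := (⟨b, (fiberEquiv hlin hb).symm y⟩ : 𝒱.Total))
    (e.mem_source.2 hb)
  rwa [← fiberEquiv_apply hlin hb, LinearEquiv.apply_symm_apply] at h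

open Classical in
/-- The section `x ↦ χ(x) y` in a local trivialization, extended by zero. It serves to produce
global sections with prescribed values. -/
def localSection (χ : B → ℂ) (y : EuclideanSpace ℂ (Fin n)) (x : B) : 𝒱.Fiber x :=
  if hx : x ∈ e.baseSet then χ x • (fiberEquiv hlin hx).symm y else 0

theorem localSection_eq_zero {χ : B → ℂ} (y : EuclideanSpace ℂ (Fin n)) {x : B} (hx : χ x = 0) :
    localSection hlin χ y x = 0 := by
  simp [localSection, hx]

theorem continuous_sec_localSection {χ : B → ℂ} (hχ : Continuous χ)
    (hsupp : tsupport χ ⊆ e.baseSet) (y : EuclideanSpace ℂ (Fin n)) :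
    Continuous (sec (localSection hlin χ y)) := by
  refine continuous_iff_continuousAt.2 fun x ↦ ?_
  by_cases hx : x ∈ e.baseSet
  · refine (continuousAt_sec_iff e hx _).2
      ((hχ.smul (continuous_const (y := y))).continuousAt.congr ?_)
    filter_upwards [e.open_baseSet.mem_nhds hx] with z hz
    change χ z • y = fiberEquiv hlin hz (localSection hlin χ y z)
    rw [localSection, dif_pos hz, map_smul, LinearEquiv.apply_symm_apply]
  · refine (continuous_sec_zero (𝒱 := 𝒱)).continuousAt.congr ?_
    filter_upwards [(isClosed_tsupport χ).isOpen_compl.mem_nhds fun h ↦ hx (hsupp h)] with z hz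
    simp [sec, localSection_eq_zero hlin y (image_eq_zero_of_notMem_tsupport hz)]

end LocalTrivialization

instance finiteDimensional_fiber (b : B) : FiniteDimensional ℂ (𝒱.Fiber b) := by
  obtain ⟨n, e, -, hb, hlin⟩ := 𝒱.locally_trivial b
  exact (fiberEquiv hlin hb).symm.finiteDimensional

instance nontrivial_fiber (b : B) : Nontrivial (𝒱.Fiber b) := by
  obtain ⟨n, e, hn, hb, hlin⟩ := 𝒱.locally_trivial b
  have : Nonempty (Fin n) := ⟨⟨0, hn⟩⟩
  exact (fiberEquiv hlin hb).toEquiv.nontrivial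

theorem exists_continuous_sec_apply_eq [R1Space B] [LocallyCompactSpace B] (b : B)
    (v : 𝒱.Fiber b) :
    ∃ ξ : ∀ x, 𝒱.Fiber x, Continuous (sec ξ) ∧ ξ b = v ∧ ∀ᶠ x in cocompact B, ξ x = 0 := by
  obtain ⟨n, e, -, hb, hlin⟩ := 𝒱.locally_trivial b
  obtain ⟨χ, hχb, hcompact, hsupp, -⟩ := exists_continuousMap_one_of_isCompact_subset_isOpen
    (isCompact_singleton (x := b)) e.open_baseSet (Set.singleton_subset_iff.2 hb)
  have hsupp' : tsupport (fun x ↦ (χ x : ℂ)) ⊆ tsupport χ :=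
    closure_mono fun x hx h ↦ hx (by simp [h])
  refine ⟨localSection hlin (fun x ↦ (χ x : ℂ)) (fiberEquiv hlin hb v),
    continuous_sec_localSection hlin (by fun_prop) (hsupp'.trans hsupp) _, ?_, ?_⟩
  · simp [localSection, hb, hχb rfl]
  · filter_upwards [hcompact.compl_mem_cocompact] with x hx
    exact localSection_eq_zero hlin _ (by simp [image_eq_zero_of_notMem_tsupport hx])

namespace HermitianMetric

variable (β : 𝒱.HermitianMetric)

/-! ### The norm on the fibres -/

section Fiber

variable {b : B}

/-- The norm `√β(v, v)` on the fibre at `b`. It is bundled as a seminorm rather than installed as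
a norm instance because it depends on `β`. -/
def fiberNorm (b : B) : Seminorm ℂ (𝒱.Fiber b) :=
  letI := (β.core b).toNormedAddCommGroup
  letI := InnerProductSpace.ofCore (β.core b).toCore
  normSeminorm ℂ (𝒱.Fiber b)

theorem ip_self (v : 𝒱.Fiber b) : β.ip v v = ((β.fiberNorm b v ^ 2 : ℝ) : ℂ) := by
  let := (β.core b).toNormedAddCommGroup
  let := InnerProductSpace.ofCore (β.core b).toCore
  rw [Complex.ofReal_pow]
  exact inner_self_eq_norm_sq_to_K (𝕜 := ℂ) v

theorem norm_ip_self (v : 𝒱.Fiber b) : ‖β.ip v v‖ = β.fiberNorm b v ^ 2 := by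
  rw [ip_self, Complex.norm_real, Real.norm_of_nonneg (sq_nonneg _)]

theorem fiberNorm_eq_sqrt (v : 𝒱.Fiber b) : β.fiberNorm b v = √‖β.ip v v‖ := by
  rw [norm_ip_self, Real.sqrt_sq (apply_nonneg _ v)]

open scoped ComplexOrder in
theorem ip_self_nonneg (v : 𝒱.Fiber b) : 0 ≤ β.ip v v := by
  rw [ip_self, Complex.zero_le_real]
  positivity

theorem fiberNorm_eq_zero {v : 𝒱.Fiber b} : β.fiberNorm b v = 0 ↔ v = 0 := by
  let := (β.core b).toNormedAddCommGroup
  exact norm_eq_zero (a := v)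

theorem fiberNorm_pos {v : 𝒱.Fiber b} : 0 < β.fiberNorm b v ↔ v ≠ 0 := by
  rw [(apply_nonneg _ v).lt_iff_ne', Ne, fiberNorm_eq_zero]

theorem ip_self_eq_zero {v : 𝒱.Fiber b} : β.ip v v = 0 ↔ v = 0 := by
  rw [← norm_eq_zero, norm_ip_self, sq_eq_zero_iff, fiberNorm_eq_zero]

theorem ip_add_right (u v w : 𝒱.Fiber b) : β.ip u (v + w) = β.ip u v + β.ip u w := by
  let := (β.core b).toNormedAddCommGroup
  let := InnerProductSpace.ofCore (β.core b).toCore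
  exact inner_add_right (𝕜 := ℂ) u v w

theorem ip_smul_right (c : ℂ) (v w : 𝒱.Fiber b) : β.ip v (c • w) = c * β.ip v w := by
  let := (β.core b).toNormedAddCommGroup
  let := InnerProductSpace.ofCore (β.core b).toCore
  exact inner_smul_right (𝕜 := ℂ) v w c

theorem star_ip (v w : 𝒱.Fiber b) : star (β.ip v w) = β.ip w v :=
  (β.core b).conj_inner_symm w v

theorem ip_smul_left (c : ℂ) (v w : 𝒱.Fiber b) : β.ip (c • v) w = star c * β.ip v w :=
  (β.core b).smul_left v w c

theorem exists_fiberNorm_sub_lt_of_cauchy {u : ℕ → 𝒱.Fiber b}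
    (hu : ∀ ε > 0, ∃ N, ∀ m ≥ N, ∀ n ≥ N, β.fiberNorm b (u m - u n) < ε) :
    ∃ v, ∀ ε > 0, ∃ N, ∀ n ≥ N, β.fiberNorm b (u n - v) < ε := by
  let := (β.core b).toNormedAddCommGroup
  let := InnerProductSpace.ofCore (β.core b).toCore
  have : CompleteSpace (𝒱.Fiber b) := FiniteDimensional.complete ℂ _
  have hcauchy : CauchySeq u := Metric.cauchySeq_iff.2 fun ε hε ↦ by
    simp only [dist_eq_norm]
    exact hu ε hε
  obtain ⟨v, hv⟩ := cauchySeq_tendsto_of_complete hcauchy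
  simp only [Metric.tendsto_atTop, dist_eq_norm] at hv
  exact ⟨v, hv⟩

end Fiber

theorem continuous_fiberNorm : Continuous (fun z : 𝒱.Total ↦ β.fiberNorm z.1 z.2) := by
  have hdiag : Continuous (fun z : 𝒱.Total ↦
      (⟨z.1, (z.2, z.2)⟩ : TotalSpace (Unit × Unit) (𝒱.Fiber ×ᵇ 𝒱.Fiber))) :=
    (FiberBundle.Prod.isInducing_diag Unit 𝒱.Fiber Unit 𝒱.Fiber).continuous_iff.2
      (continuous_id.prodMk continuous_id)
  simp only [fiberNorm_eq_sqrt]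
  exact (β.continuous_inner.comp hdiag).norm.sqrt

theorem continuous_fiberNorm_sec {ξ : ∀ b, 𝒱.Fiber b} (hξ : Continuous (sec ξ)) :
    Continuous (fun b ↦ β.fiberNorm b (ξ b)) :=
  β.continuous_fiberNorm.comp hξ

theorem exists_norm_trivialization_le {n : ℕ}
    {e : Trivialization (EuclideanSpace ℂ (Fin n)) (TotalSpace.proj : 𝒱.Total → B)}
    (hlin : ∀ x ∈ e.baseSet, IsLinearMap ℂ (fun v : 𝒱.Fiber x ↦ (e ⟨x, v⟩).2))
    {b : B} (hb : b ∈ e.baseSet) :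
    ∃ C > 0, ∀ᶠ x in 𝓝 b, ∀ v : 𝒱.Fiber x, ‖(e ⟨x, v⟩).2‖ ≤ C * β.fiberNorm x v := by
  let N (x : B) (y : EuclideanSpace ℂ (Fin n)) : ℝ :=
    β.fiberNorm _ (e.toOpenPartialHomeomorph.symm (x, y)).2
  have hN : ∀ x (hx : x ∈ e.baseSet) y, N x y = β.fiberNorm x ((fiberEquiv hlin hx).symm y) :=
    fun x hx y ↦ by
      change β.fiberNorm _ (e.toOpenPartialHomeomorph.symm (x, y)).2 = _
      rw [toOpenPartialHomeomorph_symm_apply hlin hx]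
  have hcont : ∀ y, ContinuousAt (Function.uncurry N) (b, y) := fun y ↦
    β.continuous_fiberNorm.continuousAt.comp
      (e.toOpenPartialHomeomorph.continuousAt_symm (e.mem_target.2 hb))
  have hbase := e.open_baseSet.mem_nhds hb
  have hsmul : ∀ᶠ x in 𝓝 b, ∀ (c : ℂ) y, N x (c • y) = ‖c‖ * N x y := by
    filter_upwards [hbase] with x hx c y
    rw [hN x hx, hN x hx, map_smul, map_smul_eq_mul]
  have hpos : ∀ y ≠ 0, 0 < N b y := fun y hy ↦ by
    simpa [hN b hb, fiberNorm_pos] using hy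
  obtain ⟨C, hC, hle⟩ := exists_eventually_norm_le_mul_of_homogeneous hcont hsmul hpos
  refine ⟨C, hC, ?_⟩
  filter_upwards [hle, hbase] with x hx hxe v
  have hle_v := hx (fiberEquiv hlin hxe v)
  rwa [hN x hxe, LinearEquiv.symm_apply_apply, fiberEquiv_apply] at hle_v

/-! ### Sections vanishing at infinity -/

theorem continuous_sec_of_forall_exists_fiberNorm_sub_le {ξ : ∀ b, 𝒱.Fiber b}
    (h : ∀ ε > 0, ∃ η : ∀ b, 𝒱.Fiber b,
      Continuous (sec η) ∧ ∀ x, β.fiberNorm x (ξ x - η x) ≤ ε) :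
    Continuous (sec ξ) := by
  refine continuous_iff_continuousAt.2 fun b ↦ ?_
  obtain ⟨n, e, -, hb, hlin⟩ := 𝒱.locally_trivial b
  obtain ⟨C, hC, hCle⟩ := β.exists_norm_trivialization_le hlin hb
  refine (continuousAt_sec_iff e hb ξ).2
    (continuousAt_of_locally_uniform_approx_of_continuousAt fun u hu ↦ ?_)
  obtain ⟨ε, hε, hεu⟩ := Metric.mem_uniformity_dist.1 hu
  obtain ⟨η, hη, hle⟩ := h (ε / (2 * C)) (by positivity)
  refine ⟨_, inter_mem hCle (e.open_baseSet.mem_nhds hb), fun x ↦ (e (sec η x)).2,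
    (continuousAt_sec_iff e hb η).1 hη.continuousAt, fun x ⟨hx, hxe⟩ ↦ hεu ?_⟩
  calc dist (e (sec ξ x)).2 (e (sec η x)).2 = ‖(e ⟨x, ξ x - η x⟩).2‖ := by
        rw [dist_eq_norm, (hlin x hxe).map_sub (ξ x) (η x)]
        rfl
    _ ≤ C * β.fiberNorm x (ξ x - η x) := hx _
    _ ≤ C * (ε / (2 * C)) := by gcongr; exact hle x
    _ = ε / 2 := by field_simp
    _ < ε := half_lt_self hε

theorem tendsto_ip_self_iff {ξ : ∀ b, 𝒱.Fiber b} {l : Filter B} :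
    Tendsto (fun b ↦ β.ip (ξ b) (ξ b)) l (𝓝 0) ↔
      Tendsto (fun b ↦ β.fiberNorm b (ξ b)) l (𝓝 0) := by
  rw [tendsto_zero_iff_norm_tendsto_zero]
  constructor <;> intro h
  · simpa [fiberNorm_eq_sqrt] using h.sqrt
  · simpa [norm_ip_self] using h.pow 2

theorem mem_sections_of_forall_exists_fiberNorm_sub_le {ξ : ∀ b, 𝒱.Fiber b}
    (h : ∀ ε > 0, ∃ η ∈ β.sections, ∀ x, β.fiberNorm x (ξ x - η x) ≤ ε) : ξ ∈ β.sections := by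
  refine ⟨β.continuous_sec_of_forall_exists_fiberNorm_sub_le fun ε hε ↦ ?_,
    β.tendsto_ip_self_iff.2 (Metric.tendsto_nhds.2 fun ε hε ↦ ?_)⟩
  · obtain ⟨η, hη, hle⟩ := h ε hε
    exact ⟨η, hη.1, hle⟩
  · obtain ⟨η, hη, hle⟩ := h (ε / 2) (half_pos hε)
    filter_upwards [(β.tendsto_ip_self_iff.1 hη.2).eventually (gt_mem_nhds (half_pos hε))]
      with x hx
    rw [Real.dist_0_eq_abs, abs_of_nonneg (apply_nonneg _ _)]
    calc β.fiberNorm x (ξ x) ≤ β.fiberNorm x (ξ x - η x) + β.fiberNorm x (η x) := by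
          simpa using map_add_le_add (β.fiberNorm x) (ξ x - η x) (η x)
      _ < ε := by linarith [hle x]

theorem exists_section_apply_eq [R1Space B] [LocallyCompactSpace B] (b : B) (v : 𝒱.Fiber b) :
    ∃ ξ : β.sections, ξ.1 b = v := by
  obtain ⟨ξ, hξ, hv, hzero⟩ := exists_continuous_sec_apply_eq b v
  refine ⟨⟨ξ, hξ, (tendsto_const_nhds (x := (0 : ℂ))).congr' ?_⟩, hv⟩
  filter_upwards [hzero] with x hx
  exact (β.ip_self_eq_zero.2 hx).symm

/-! ### The supremum norm of a section -/

theorem baseInner_apply (ξ η : β.sections) (b : B) :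
    β.baseInner ξ η b = β.ip (ξ.1 b) (η.1 b) := rfl

theorem moduleNorm_baseInner_le_iff (ξ : β.sections) {C : ℝ} (hC : 0 ≤ C) :
    moduleNorm β.baseInner ξ ≤ C ↔ ∀ b, β.fiberNorm b (ξ.1 b) ≤ C := by
  rw [moduleNorm, Real.sqrt_le_left hC, norm_zeroAtInfty_le_iff _ (sq_nonneg C)]
  refine forall_congr' fun b ↦ ?_
  rw [baseInner_apply, norm_ip_self, sq_le_sq₀ (apply_nonneg _ _) hC]

theorem fiberNorm_le_moduleNorm_baseInner (ξ : β.sections) (b : B) :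
    β.fiberNorm b (ξ.1 b) ≤ moduleNorm β.baseInner ξ :=
  (β.moduleNorm_baseInner_le_iff ξ (Real.sqrt_nonneg _)).1 le_rfl b

theorem moduleNorm_baseInner_sub_comm (ξ η : β.sections) :
    moduleNorm β.baseInner (ξ - η) = moduleNorm β.baseInner (η - ξ) := by
  have hle : ∀ ξ η : β.sections,
      moduleNorm β.baseInner (ξ - η) ≤ moduleNorm β.baseInner (η - ξ) := fun ξ η ↦
    (β.moduleNorm_baseInner_le_iff _ (Real.sqrt_nonneg _)).2 fun b ↦
      (map_sub_rev (β.fiberNorm b) _ _).trans_le (β.fiberNorm_le_moduleNorm_baseInner (η - ξ) b)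
  exact le_antisymm (hle ξ η) (hle η ξ)

theorem moduleNorm_baseInner_sub_le (ξ η ζ : β.sections) :
    moduleNorm β.baseInner (ξ - ζ) ≤
      moduleNorm β.baseInner (ξ - η) + moduleNorm β.baseInner (η - ζ) :=
  (β.moduleNorm_baseInner_le_iff _ (add_nonneg (Real.sqrt_nonneg _) (Real.sqrt_nonneg _))).2
    fun b ↦ (le_map_sub_add_map_sub (β.fiberNorm b) _ (η.1 b) _).trans
      (add_le_add (β.fiberNorm_le_moduleNorm_baseInner (ξ - η) b)
        (β.fiberNorm_le_moduleNorm_baseInner (η - ζ) b))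

theorem exists_section_fiberNorm_sub_le_of_cauchy {u : ℕ → β.sections}
    (hu : ∀ ε > 0, ∃ N, ∀ m ≥ N, ∀ n ≥ N, ∀ x, β.fiberNorm x ((u m).1 x - (u n).1 x) < ε) :
    ∃ ξ : β.sections, ∀ ε > 0, ∃ N, ∀ n ≥ N, ∀ x, β.fiberNorm x ((u n).1 x - ξ.1 x) ≤ ε := by
  have hpointwise : ∀ x, ∃ v, ∀ ε > 0, ∃ N, ∀ n ≥ N, β.fiberNorm x ((u n).1 x - v) < ε :=
    fun x ↦ β.exists_fiberNorm_sub_lt_of_cauchy fun ε hε ↦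
      (hu ε hε).imp fun N hN m hm n hn ↦ hN m hm n hn x
  choose ξ hξ using hpointwise
  have huniform : ∀ ε > 0, ∃ N, ∀ n ≥ N, ∀ x, β.fiberNorm x ((u n).1 x - ξ x) ≤ ε := by
    intro ε hε
    obtain ⟨N, hN⟩ := hu ε hε
    refine ⟨N, fun n hn x ↦ le_of_forall_pos_le_add fun δ hδ ↦ ?_⟩
    obtain ⟨M, hM⟩ := hξ x δ hδ
    calc β.fiberNorm x ((u n).1 x - ξ x)
        ≤ β.fiberNorm x ((u n).1 x - (u (max M N)).1 x) +
          β.fiberNorm x ((u (max M N)).1 x - ξ x) := le_map_sub_add_map_sub _ _ _ _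
      _ ≤ ε + δ := add_le_add (hN n hn _ (le_max_right _ _) x).le (hM _ (le_max_left _ _)).le
  have hmem : ξ ∈ β.sections := β.mem_sections_of_forall_exists_fiberNorm_sub_le fun ε hε ↦ by
    obtain ⟨N, hN⟩ := huniform ε hε
    exact ⟨(u N).1, (u N).2, fun x ↦ by simpa only [map_sub_rev] using hN N le_rfl x⟩
  exact ⟨⟨ξ, hmem⟩, huniform⟩

theorem isModuleComplete_baseInner : IsModuleComplete β.baseInner := by
  intro u hu
  obtain ⟨ξ, hξ⟩ := β.exists_section_fiberNorm_sub_le_of_cauchy (u := u) fun ε hε ↦ by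
    obtain ⟨N, hN⟩ := hu ε hε
    exact ⟨N, fun m hm n hn x ↦
      lt_of_le_of_lt (β.fiberNorm_le_moduleNorm_baseInner (u m - u n) x) (hN m hm n hn)⟩
  refine ⟨ξ, fun ε hε ↦ ?_⟩
  obtain ⟨N, hN⟩ := hξ (ε / 2) (half_pos hε)
  exact ⟨N, fun n hn ↦ lt_of_le_of_lt
    ((β.moduleNorm_baseInner_le_iff (u n - ξ) (half_pos hε).le).2 (hN n hn)) (half_lt_self hε)⟩

theorem exists_section_apply_eq_fiberNorm_le [R1Space B] [LocallyCompactSpace B] (b : B)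
    (v : 𝒱.Fiber b) :
    ∃ ξ : β.sections, ξ.1 b = v ∧ ∀ x, β.fiberNorm x (ξ.1 x) ≤ β.fiberNorm b v := by
  rcases eq_or_ne v 0 with rfl | hv
  · exact ⟨0, rfl, fun x ↦ by simp⟩
  obtain ⟨ξ, rfl⟩ := β.exists_section_apply_eq b v
  set r := β.fiberNorm b (ξ.1 b)
  have hr : 0 < r := β.fiberNorm_pos.2 hv
  have hmax : ∀ x, 0 < max r (β.fiberNorm x (ξ.1 x)) := fun x ↦ lt_max_of_lt_left hr
  have hquot : ∀ x, ‖((r / max r (β.fiberNorm x (ξ.1 x)) : ℝ) : ℂ)‖ =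
      r / max r (β.fiberNorm x (ξ.1 x)) := fun x ↦ by
    rw [Complex.norm_real, Real.norm_of_nonneg (div_pos hr (hmax x)).le]
  let f : BoundedContinuousFunction B ℂ := .ofNormedAddCommGroup
    (fun x ↦ ((r / max r (β.fiberNorm x (ξ.1 x)) : ℝ) : ℂ))
    (Complex.continuous_ofReal.comp (continuous_const.div
      (continuous_const.max (β.continuous_fiberNorm_sec ξ.2.1)) fun x ↦ (hmax x).ne'))
    1 fun x ↦ by
      rw [hquot]
      exact div_le_one_of_le₀ (le_max_left _ _) (hmax x).le
  refine ⟨β.mulSection f ξ, ?_, fun x ↦ ?_⟩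
  · change ((r / max r r : ℝ) : ℂ) • ξ.1 b = ξ.1 b
    rw [max_self, div_self hr.ne', Complex.ofReal_one, one_smul]
  · change β.fiberNorm x (((r / max r (β.fiberNorm x (ξ.1 x)) : ℝ) : ℂ) • ξ.1 x) ≤ r
    rw [map_smul_eq_mul, hquot, div_mul_eq_mul_div, div_le_iff₀ (hmax x)]
    exact mul_le_mul_of_nonneg_left (le_max_right _ _) hr.le

/-! ### Multiplication operators -/

/-- The action of `C₀(B)` on `Γ₀(𝒱)` by multiplication operators. -/
def multiplication : C₀(B, ℂ) →ₗ[ℂ] β.sections →ₗ[ℂ] β.sections where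
  toFun g := β.mulSection g.toBCF
  map_add' g h := LinearMap.ext fun ξ ↦ Subtype.ext <| funext fun b ↦
    add_smul (g b) (h b) (ξ.1 b)
  map_smul' c g := LinearMap.ext fun ξ ↦ Subtype.ext <| funext fun b ↦
    smul_assoc c (g b) (ξ.1 b)

theorem multiplication_apply (g : C₀(B, ℂ)) (ξ : β.sections) (b : B) :
    (β.multiplication g ξ).1 b = g b • ξ.1 b := rfl

theorem baseInner_multiplication_left (g : C₀(B, ℂ)) (ξ η : β.sections) :
    β.baseInner (β.multiplication g ξ) η = β.baseInner ξ (β.multiplication (star g) η) := by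
  ext b
  simp only [baseInner_apply, multiplication_apply, ip_smul_left, ip_smul_right,
    ZeroAtInftyContinuousMap.star_apply]

theorem moduleNorm_multiplication_le (g : C₀(B, ℂ)) (ξ : β.sections) :
    moduleNorm β.baseInner (β.multiplication g ξ) ≤ ‖g‖ * moduleNorm β.baseInner ξ := by
  refine (β.moduleNorm_baseInner_le_iff _
    (mul_nonneg (norm_nonneg g) (Real.sqrt_nonneg _))).2 fun b ↦ ?_
  rw [multiplication_apply, map_smul_eq_mul]
  exact mul_le_mul (norm_zeroAtInfty_apply_le g b) (β.fiberNorm_le_moduleNorm_baseInner ξ b)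
    (apply_nonneg _ _) (norm_nonneg g)

theorem norm_le_of_moduleNorm_multiplication_le [R1Space B] [LocallyCompactSpace B]
    {g : C₀(B, ℂ)} {C : ℝ} (hC : 0 ≤ C)
    (h : ∀ ξ, moduleNorm β.baseInner (β.multiplication g ξ) ≤ C * moduleNorm β.baseInner ξ) :
    ‖g‖ ≤ C := by
  refine (norm_zeroAtInfty_le_iff g hC).2 fun b ↦ ?_
  obtain ⟨v, hv⟩ := exists_ne (0 : 𝒱.Fiber b)
  obtain ⟨ξ, rfl, hξ⟩ := β.exists_section_apply_eq_fiberNorm_le b v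
  refine le_of_mul_le_mul_right ?_ (β.fiberNorm_pos.2 hv)
  calc ‖g b‖ * β.fiberNorm b (ξ.1 b) = β.fiberNorm b ((β.multiplication g ξ).1 b) := by
        rw [multiplication_apply, map_smul_eq_mul]
    _ ≤ moduleNorm β.baseInner (β.multiplication g ξ) :=
        β.fiberNorm_le_moduleNorm_baseInner _ b
    _ ≤ C * moduleNorm β.baseInner ξ := h ξ
    _ ≤ C * β.fiberNorm b (ξ.1 b) := by
        gcongr
        exact (β.moduleNorm_baseInner_le_iff ξ (apply_nonneg _ _)).2 hξ

theorem eq_of_moduleNorm_baseInner_sub_le {ξ η : β.sections} {C : ℝ}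
    (h : ∀ ε > 0, moduleNorm β.baseInner (ξ - η) ≤ ε * C) : ξ = η := by
  have hzero : moduleNorm β.baseInner (ξ - η) ≤ 0 := by
    refine ge_of_tendsto (x := 𝓝[>] (0 : ℝ)) (f := fun ε ↦ ε * C) ?_
      (eventually_mem_nhdsWithin.mono h)
    exact tendsto_nhdsWithin_of_tendsto_nhds ((continuous_mul_const C).tendsto' 0 0 (zero_mul C))
  refine Subtype.ext <| funext fun b ↦ sub_eq_zero.1 (β.fiberNorm_eq_zero.1 ?_)
  exact le_antisymm ((β.moduleNorm_baseInner_le_iff _ le_rfl).1 hzero b) (apply_nonneg _ _)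

theorem mem_range_multiplication_of_forall_exists_moduleNorm_sub_le [R1Space B]
    [LocallyCompactSpace B] {T : β.sections →ₗ[ℂ] β.sections}
    (h : ∀ ε > 0, ∃ g : C₀(B, ℂ), ∀ ξ,
      moduleNorm β.baseInner (T ξ - β.multiplication g ξ) ≤ ε * moduleNorm β.baseInner ξ) :
    T ∈ LinearMap.range β.multiplication := by
  choose! g hg using h
  have hcauchy : ∀ ε > 0, ∀ δ > 0, dist (g ε) (g δ) ≤ ε + δ := fun ε hε δ hδ ↦ by
    rw [dist_eq_norm]
    refine β.norm_le_of_moduleNorm_multiplication_le (add_pos hε hδ).le fun ξ ↦ ?_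
    rw [map_sub, LinearMap.sub_apply, add_mul]
    refine (β.moduleNorm_baseInner_sub_le _ (T ξ) _).trans (add_le_add ?_ (hg δ hδ ξ))
    rw [moduleNorm_baseInner_sub_comm]
    exact hg ε hε ξ
  obtain ⟨g₀, hg₀⟩ := exists_forall_dist_le_of_dist_le_add hcauchy
  refine ⟨g₀, LinearMap.ext fun ξ ↦ Eq.symm ?_⟩
  refine β.eq_of_moduleNorm_baseInner_sub_le (C := 2 * moduleNorm β.baseInner ξ) fun ε hε ↦ ?_
  calc moduleNorm β.baseInner (T ξ - β.multiplication g₀ ξ)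
      ≤ moduleNorm β.baseInner (T ξ - β.multiplication (g ε) ξ) +
        moduleNorm β.baseInner (β.multiplication (g ε - g₀) ξ) := by
        rw [map_sub, LinearMap.sub_apply]
        exact β.moduleNorm_baseInner_sub_le _ _ _
    _ ≤ ε * moduleNorm β.baseInner ξ + ε * moduleNorm β.baseInner ξ := by
        refine add_le_add (hg ε hε ξ) ((β.moduleNorm_multiplication_le _ ξ).trans ?_)
        rw [← dist_eq_norm]
        exact mul_le_mul_of_nonneg_right (hg₀ ε hε) (Real.sqrt_nonneg _)
    _ = ε * (2 * moduleNorm β.baseInner ξ) := by ring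

/-! ### Fullness -/

theorem exists_finset_sections_le_sum_fiberNorm_sq [R1Space B] [LocallyCompactSpace B]
    {K : Set B} (hK : IsCompact K) :
    ∃ (t : Finset β.sections) (δ : ℝ), 0 < δ ∧
      ∀ x ∈ K, δ ≤ ∑ ξ ∈ t, β.fiberNorm x (ξ.1 x) ^ 2 := by
  classical
  have hnonzero : ∀ x, ∃ ξ : β.sections, 0 < β.fiberNorm x (ξ.1 x) := fun x ↦ by
    obtain ⟨v, hv⟩ := exists_ne (0 : 𝒱.Fiber x)
    obtain ⟨ξ, rfl⟩ := β.exists_section_apply_eq x v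
    exact ⟨ξ, β.fiberNorm_pos.2 hv⟩
  choose s hs using hnonzero
  have hcont : ∀ ξ : β.sections, Continuous (fun y ↦ β.fiberNorm y (ξ.1 y)) :=
    fun ξ ↦ β.continuous_fiberNorm_sec ξ.2.1
  obtain ⟨t, -, ht⟩ := hK.elim_nhds_subcover (fun x ↦ {y | 0 < β.fiberNorm y ((s x).1 y)})
    fun x _ ↦ (isOpen_lt continuous_const (hcont (s x))).mem_nhds (hs x)
  have hpos : ∀ y ∈ K, 0 < ∑ ξ ∈ t.image s, β.fiberNorm y (ξ.1 y) ^ 2 := by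
    intro y hy
    obtain ⟨x, hx, hxy⟩ := Set.mem_iUnion₂.1 (ht hy)
    exact Finset.sum_pos' (fun _ _ ↦ sq_nonneg _)
      ⟨s x, Finset.mem_image_of_mem s hx, pow_pos hxy 2⟩
  obtain ⟨δ, hδ, hle⟩ := hK.exists_forall_le'
    (continuous_finsetSum _ fun ξ _ ↦ (hcont ξ).pow 2).continuousOn hpos
  exact ⟨t.image s, δ, hδ, hle⟩

theorem exists_mem_span_baseInner_norm_sub_le [R1Space B] [LocallyCompactSpace B]
    (g : C₀(B, ℂ)) {ε : ℝ} (hε : 0 < ε) :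
    ∃ f ∈ Submodule.span ℂ (Set.range (Function.uncurry β.baseInner)), ‖g - f‖ ≤ ε := by
  obtain ⟨t, δ, hδ, hle⟩ :=
    β.exists_finset_sections_le_sum_fiberNorm_sq (isCompact_setOf_le_norm_zeroAtInfty g hε)
  let H : B → ℝ := fun x ↦ ∑ ξ ∈ t, β.fiberNorm x (ξ.1 x) ^ 2
  have hH : Continuous H :=
    continuous_finsetSum _ fun ξ _ ↦ (β.continuous_fiberNorm_sec ξ.2.1).pow 2
  obtain ⟨k, hk⟩ := exists_boundedContinuous_norm_sub_smul_le g.toBCF hH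
    (fun x ↦ Finset.sum_nonneg fun ξ _ ↦ sq_nonneg _) hδ hε.le hle
  refine ⟨∑ ξ ∈ t, β.baseInner ξ (β.mulSection k ξ), Submodule.sum_mem _ fun ξ _ ↦
    Submodule.subset_span ⟨(ξ, β.mulSection k ξ), rfl⟩,
    (norm_zeroAtInfty_le_iff _ hε.le).2 fun x ↦ ?_⟩
  have hsum : (∑ ξ ∈ t, β.baseInner ξ (β.mulSection k ξ)) x = H x • k x := by
    rw [zeroAtInfty_sum_apply, Finset.sum_smul]
    refine Finset.sum_congr rfl fun ξ _ ↦ ?_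
    change β.ip (ξ.1 x) (k x • ξ.1 x) = _
    rw [ip_smul_right, ip_self, mul_comm, Complex.real_smul]
  rw [ZeroAtInftyContinuousMap.sub_apply, hsum]
  exact hk x

/-! ### Line bundles -/

theorem ip_smul_eq_ip_smul_of_finrank_eq_one {b : B} (h : Module.finrank ℂ (𝒱.Fiber b) = 1)
    (u v w : 𝒱.Fiber b) : β.ip v w • u = β.ip v u • w := by
  obtain ⟨e, -, he⟩ := finrank_eq_one_iff'.1 h
  obtain ⟨a, rfl⟩ := he u
  obtain ⟨c, rfl⟩ := he w
  rw [ip_smul_right, ip_smul_right, smul_smul, smul_smul]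
  ring_nf

theorem finrank_eq_one_of_forall_ip_smul_eq {b : B}
    (h : ∀ u v : 𝒱.Fiber b, ∃ c : ℂ, ∀ w, β.ip v w • u = c • w) :
    Module.finrank ℂ (𝒱.Fiber b) = 1 := by
  obtain ⟨v, hv⟩ := exists_ne (0 : 𝒱.Fiber b)
  refine finrank_eq_one_iff'.2 ⟨v, hv, fun u ↦ ?_⟩
  obtain ⟨c, hc⟩ := h u v
  refine ⟨(β.ip v v)⁻¹ * c, ?_⟩
  rw [mul_smul, ← hc, inv_smul_smul₀ (mt β.ip_self_eq_zero.1 hv)]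

theorem isLineBundle_of_forall_exists_ip_smul_eq [R1Space B] [LocallyCompactSpace B]
    (h : ∀ ξ η : β.sections, ∃ g : B → ℂ, ∀ (ζ : β.sections) b,
      β.ip (η.1 b) (ζ.1 b) • ξ.1 b = g b • ζ.1 b) : 𝒱.IsLineBundle := by
  refine fun b ↦ β.finrank_eq_one_of_forall_ip_smul_eq fun u v ↦ ?_
  obtain ⟨ξ, rfl⟩ := β.exists_section_apply_eq b u
  obtain ⟨η, rfl⟩ := β.exists_section_apply_eq b v
  obtain ⟨g, hg⟩ := h ξ η
  refine ⟨g b, fun w ↦ ?_⟩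
  obtain ⟨ζ, rfl⟩ := β.exists_section_apply_eq b w
  exact hg ζ b

end HermitianMetric

end ComplexVectorBundle

namespace Correspondence

variable {X : Type*} [TopologicalSpace X] {U V : Opens X} {𝒱 : ComplexVectorBundle U}
  (θ : U ≃ₜ V) (β : 𝒱.HermitianMetric)

/-! ### The Hilbert module structures -/

theorem rightMul_apply (ξ : β.sections) (f : C₀(X, ℂ)) (x : U) :
    (rightMul β ξ f).1 x = f x • ξ.1 x := rfl

theorem structureMap_apply (f : C₀(X, ℂ)) (ξ : β.sections) (x : U) :
    (structureMap θ β f ξ).1 x = f (θ x) • ξ.1 x := rfl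

theorem leftMul_apply (f : C₀(X, ℂ)) (ξ : β.sections) (x : U) :
    (leftMul θ β f ξ).1 x = f (θ x) • ξ.1 x := rfl

theorem exists_homeomorph_apply_eq_or_notMem (x : X) : (∃ t, (θ t : X) = x) ∨ x ∉ V :=
  or_iff_not_imp_right.2 fun hx ↦
    ⟨θ.symm ⟨x, not_not.1 hx⟩, congrArg Subtype.val (θ.apply_symm_apply _)⟩

variable [T2Space X]

theorem rightInner_apply_coe (ξ η : β.sections) (x : U) :
    rightInner β ξ η x = β.ip (ξ.1 x) (η.1 x) :=
  extendZero_apply_coe U _ x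

theorem leftInner_apply (ξ η : β.sections) (x : U) :
    leftInner θ β ξ η (θ x) = β.ip (η.1 x) (ξ.1 x) := by
  rw [leftInner, extendZero_apply_coe]
  change β.baseInner η ξ (θ.symm (θ x)) = _
  rw [θ.symm_apply_apply, β.baseInner_apply]

theorem leftInner_apply_of_notMem (ξ η : β.sections) {x : X} (hx : x ∉ V) :
    leftInner θ β ξ η x = 0 :=
  extendZero_apply_of_notMem V _ hx

theorem moduleNorm_leftInner : moduleNorm (leftInner θ β) = moduleNorm β.baseInner :=
  funext fun ξ ↦ by
    rw [moduleNorm, leftInner, norm_extendZero, norm_zeroAtInfty_comp_homeomorph, moduleNorm]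

theorem moduleNorm_rightInner : moduleNorm (rightInner β) = moduleNorm β.baseInner :=
  funext fun ξ ↦ by rw [moduleNorm, rightInner, norm_extendZero, moduleNorm]

open scoped ComplexOrder in
theorem isLeftHilbertModule : IsLeftHilbertModule (leftMul θ β) (leftInner θ β) where
  add_lact a b ξ := Subtype.ext <| funext fun t ↦ add_smul (a (θ t)) (b (θ t)) (ξ.1 t)
  lact_add a ξ η := Subtype.ext <| funext fun t ↦ smul_add (a (θ t)) (ξ.1 t) (η.1 t)
  mul_lact a b ξ := Subtype.ext <| funext fun t ↦ mul_smul (a (θ t)) (b (θ t)) (ξ.1 t)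
  smul_lact c a ξ := Subtype.ext <| funext fun t ↦ smul_assoc c (a (θ t)) (ξ.1 t)
  lact_smul c a ξ := Subtype.ext <| funext fun t ↦ smul_comm (a (θ t)) c (ξ.1 t)
  add_ip ξ η ζ := by
    ext x
    obtain ⟨t, rfl⟩ | hx := exists_homeomorph_apply_eq_or_notMem θ x
    · simp [leftInner_apply, β.ip_add_right]
    · simp [leftInner_apply_of_notMem θ β _ _ hx]
  smul_ip c ξ η := by
    ext x
    obtain ⟨t, rfl⟩ | hx := exists_homeomorph_apply_eq_or_notMem θ x
    · simp [leftInner_apply, β.ip_smul_right]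
    · simp [leftInner_apply_of_notMem θ β _ _ hx]
  lact_ip a ξ η := by
    ext x
    obtain ⟨t, rfl⟩ | hx := exists_homeomorph_apply_eq_or_notMem θ x
    · simp [leftInner_apply, leftMul_apply, β.ip_smul_right]
    · simp [leftInner_apply_of_notMem θ β _ _ hx]
  star_ip ξ η := by
    ext x
    obtain ⟨t, rfl⟩ | hx := exists_homeomorph_apply_eq_or_notMem θ x
    · rw [ZeroAtInftyContinuousMap.star_apply, leftInner_apply, leftInner_apply, β.star_ip]
    · simp [leftInner_apply_of_notMem θ β _ _ hx]
  ip_self_nonneg ξ := exists_eq_star_mul_self_of_nonneg fun x ↦ by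
    obtain ⟨t, rfl⟩ | hx := exists_homeomorph_apply_eq_or_notMem θ x
    · rw [leftInner_apply]
      exact β.ip_self_nonneg _
    · exact (leftInner_apply_of_notMem θ β ξ ξ hx).ge
  ip_definite ξ hξ := Subtype.ext <| funext fun t ↦ β.ip_self_eq_zero.1 <| by
    rw [← leftInner_apply θ, hξ, ZeroAtInftyContinuousMap.zero_apply]
  complete := β.isModuleComplete_baseInner.of_moduleNorm_eq (moduleNorm_leftInner θ β)

-- For `θ = id` the left structure is the right one with the arguments exchanged.
theorem isRightHilbertModule : IsRightHilbertModule (rightMul β) (rightInner β) :=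
  (isLeftHilbertModule (Homeomorph.refl U) β).flip

theorem isHilbertBimodule_of_isLineBundle (h : 𝒱.IsLineBundle) :
    IsHilbertBimodule (leftMul θ β) (leftInner θ β) (rightMul β) (rightInner β) where
  right := isRightHilbertModule β
  left := isLeftHilbertModule θ β
  assoc a ξ b := Subtype.ext <| funext fun t ↦ smul_comm (a (θ t)) (b t) (ξ.1 t)
  compat ξ η ζ := Subtype.ext <| funext fun t ↦ by
    rw [leftMul_apply, leftInner_apply, rightMul_apply, rightInner_apply_coe]
    exact β.ip_smul_eq_ip_smul_of_finrank_eq_one (h t) _ _ _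

/-! ### Compact operators -/

theorem structureMap_extendZero (g : C₀(V, ℂ)) :
    structureMap θ β (extendZero V g) = β.multiplication (g.comp θ.toCocompactMap) :=
  LinearMap.ext fun ξ ↦ Subtype.ext <| funext fun t ↦ by
    rw [structureMap_apply, extendZero_apply_coe]
    rfl

theorem image_structureMap_idealOfOpen :
    structureMap θ β '' idealOfOpen V = LinearMap.range β.multiplication := by
  rw [← range_extendZero, ← Set.range_comp, LinearMap.coe_range]
  have hcomp : structureMap θ β ∘ extendZero V =
      β.multiplication ∘ fun g ↦ g.comp θ.toCocompactMap :=
    funext (structureMap_extendZero θ β)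
  rw [hcomp]
  refine Function.Surjective.range_comp (fun g ↦ ⟨g.comp θ.symm.toCocompactMap, ?_⟩) _
  ext t
  exact congrArg g (θ.symm_apply_apply t)

theorem isAdjointable_multiplication (g : C₀(U, ℂ)) :
    IsAdjointable (rightInner β) (β.multiplication g) :=
  ⟨β.multiplication (star g), fun ξ η ↦
    congrArg (extendZero U) (β.baseInner_multiplication_left g ξ η)⟩

theorem rightMul_rightInner_eq_multiplication (h : 𝒱.IsLineBundle) (ξ η ζ : β.sections) :
    rightMul β ξ (rightInner β η ζ) = β.multiplication (β.baseInner η ξ) ζ :=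
  Subtype.ext <| funext fun t ↦ by
    rw [rightMul_apply, rightInner_apply_coe]
    exact β.ip_smul_eq_ip_smul_of_finrank_eq_one (h t) _ _ _

theorem span_rankOne_eq_map_multiplication (h : 𝒱.IsLineBundle) :
    Submodule.span ℂ {R : β.sections →ₗ[ℂ] β.sections |
        ∃ ξ η, ∀ ζ, R ζ = rightMul β ξ (rightInner β η ζ)} =
      (Submodule.span ℂ (Set.range (Function.uncurry β.baseInner))).map β.multiplication := by
  rw [Submodule.map_span, ← Set.range_comp]
  congr 1
  ext R
  simp only [rightMul_rightInner_eq_multiplication β h, ← LinearMap.ext_iff, Set.mem_ofPred_eq,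
    Set.mem_range, Prod.exists, Function.comp_apply, Function.uncurry_apply_pair, eq_comm (a := R)]
  exact exists_comm

theorem compactOperators_eq_range_multiplication [LocallyCompactSpace X]
    (h : 𝒱.IsLineBundle) :
    compactOperators (rightMul β) (rightInner β) = LinearMap.range β.multiplication := by
  have : LocallyCompactSpace U := U.isOpen.locallyCompactSpace
  ext T
  simp only [compactOperators, span_rankOne_eq_map_multiplication β h, moduleNorm_rightInner,
    Set.mem_ofPred_eq, SetLike.mem_coe]
  constructor
  · rintro ⟨-, happrox⟩
    refine β.mem_range_multiplication_of_forall_exists_moduleNorm_sub_le fun ε hε ↦ ?_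
    obtain ⟨-, ⟨g, -, rfl⟩, hg⟩ := happrox ε hε
    exact ⟨g, hg⟩
  · rintro ⟨g, rfl⟩
    refine ⟨isAdjointable_multiplication β g, fun ε hε ↦ ?_⟩
    obtain ⟨f, hf, hgf⟩ := β.exists_mem_span_baseInner_norm_sub_le g hε
    refine ⟨β.multiplication f, Submodule.mem_map_of_mem hf, fun ξ ↦ ?_⟩
    rw [← LinearMap.sub_apply, ← map_sub β.multiplication]
    exact (β.moduleNorm_multiplication_le _ ξ).trans
      (mul_le_mul_of_nonneg_right hgf (Real.sqrt_nonneg _))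

theorem isLineBundle_of_forall_exists_structureMap_eq [LocallyCompactSpace X]
    (h : ∀ ξ η : β.sections, ∃ f : C₀(X, ℂ), ∀ ζ,
      structureMap θ β f ζ = rightMul β ξ (rightInner β η ζ)) : 𝒱.IsLineBundle := by
  have : LocallyCompactSpace U := U.isOpen.locallyCompactSpace
  refine β.isLineBundle_of_forall_exists_ip_smul_eq fun ξ η ↦ ?_
  obtain ⟨f, hf⟩ := h ξ η
  refine ⟨fun t ↦ f (θ t), fun ζ t ↦ ?_⟩
  rw [← structureMap_apply, hf, rightMul_apply, rightInner_apply_coe]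

theorem image_structureMap_eq_compactOperators_iff [LocallyCompactSpace X] :
    structureMap θ β '' idealOfOpen V = compactOperators (rightMul β) (rightInner β) ↔
      𝒱.IsLineBundle := by
  refine ⟨fun h ↦ isLineBundle_of_forall_exists_structureMap_eq θ β fun ξ η ↦ ?_, fun h ↦ ?_⟩
  · obtain ⟨f, -, hf⟩ :=
      h.ge ((isRightHilbertModule β).rankOne_mem_compactOperators ξ η)
    exact ⟨f, fun ζ ↦ LinearMap.congr_fun hf ζ⟩
  · rw [image_structureMap_idealOfOpen, compactOperators_eq_range_multiplication β h]

theorem isLineBundle_of_isHilbertBimodule [LocallyCompactSpace X]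
    {lip : β.sections → β.sections → C₀(X, ℂ)}
    (h : IsHilbertBimodule (leftMul θ β) lip (rightMul β) (rightInner β)) : 𝒱.IsLineBundle :=
  isLineBundle_of_forall_exists_structureMap_eq θ β fun ξ η ↦ ⟨lip ξ η, h.compat ξ η⟩

end Correspondence

end

open Correspondence in
theorem mainTheorem8_general {X : Type*} [TopologicalSpace X] [LocallyCompactSpace X] [T2Space X]
    (U V : Opens X) (θ : U ≃ₜ V) (𝒱 : ComplexVectorBundle U) (β : 𝒱.HermitianMetric) :
    (structureMap θ β '' idealOfOpen V = compactOperators (rightMul β) (rightInner β) ↔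
      𝒱.IsLineBundle) ∧
    (IsHilbertBimodule (leftMul θ β) (leftInner θ β) (rightMul β) (rightInner β) ↔
      𝒱.IsLineBundle) ∧
    ((∃ lip : β.sections → β.sections → C₀(X, ℂ),
        IsHilbertBimodule (leftMul θ β) lip (rightMul β) (rightInner β)) ↔
      𝒱.IsLineBundle) :=
  ⟨image_structureMap_eq_compactOperators_iff θ β,
    ⟨isLineBundle_of_isHilbertBimodule θ β, isHilbertBimodule_of_isLineBundle θ β⟩,
    ⟨fun ⟨_, h⟩ ↦ isLineBundle_of_isHilbertBimodule θ β h,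
      fun h ↦ ⟨leftInner θ β, isHilbertBimodule_of_isLineBundle θ β h⟩⟩⟩

open Correspondence in
theorem mainTheorem8 {X : Type*} [TopologicalSpace X] [LocallyCompactSpace X] [T2Space X]
    [SecondCountableTopology X] (U V : Opens X) (θ : U ≃ₜ V)
    (𝒱 : ComplexVectorBundle U) (β : 𝒱.HermitianMetric) :
    (structureMap θ β '' idealOfOpen V = compactOperators (rightMul β) (rightInner β) ↔
      𝒱.IsLineBundle) ∧
    (IsHilbertBimodule (leftMul θ β) (leftInner θ β) (rightMul β) (rightInner β) ↔
      𝒱.IsLineBundle) ∧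
    ((∃ lip : β.sections → β.sections → C₀(X, ℂ),
        IsHilbertBimodule (leftMul θ β) lip (rightMul β) (rightInner β)) ↔
      𝒱.IsLineBundle) := by
  exact mainTheorem8_general U V θ 𝒱 β
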